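/- Let $n\ge 0$ be an integer and $[n]=\{1,\dots,n\}$. A $\Delta$-matroid on $[n]$ is a nonempty family $\mathcal F$ of subsets of $[n]$ such that for all $A,B\in\mathcal F$ and $a\in A\Delta B$ there is $b\in A\Delta B$ (possibly $b=a$) with $A\Delta\{a,b\}\in\mathcal F$. A $\Delta$-matroid polytope is the convex hull of the indicator vectors $e_S\in\{0,1\}^n$ of the members $S$ of a $\Delta$-matroid. A function $p:\{0,1\}^n\to\mathbb R$ induces a regular subdivision of $[0,1]^n$, whose cells are the images under the projection $\mathbb R^{n+1}\to\mathbb R^n$ (deleting the last coordinate) of the lower faces of $\operatorname{conv}\{(x,p(x)) : x\in\{0,1\}^n\}$, that is, of the faces on which a linear functional with positive last coordinate attains its minimum. The function $p$ is a valuated $\Delta$-matroid if every cell of this subdivision is a $\Delta$-matroid polytope. Let the $\Delta$-Dressian $\Delta\text{-}\mathrm{Dr}(n)\subseteq\mathbb R^{\{0,1\}^n}$ be the set of all functions $p:\{0,1\}^n\to\mathbb R$ that are valuated $\Delta$-matroids, and let its dimension be the largest $d$ such that it contains a subset affinely equivalent to a $d$-dimensional ball. Theorem. The dimension of $\Delta\text{-}\mathrm{Dr}(n)$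 satisfies $$\dim \Delta\text{-}\mathrm{Dr}(n)\ \ge\ \tfrac12\, 2^n\quad\text{for all } n\ge 0,\qquad\text{and}\qquad \dim \Delta\text{-}\mathrm{Dr}(n)\ \le\ \tfrac{15}{16}\,2^n\quad\text{for all } n\ge 4.$$ -/

import Mathlib

open scoped symmDiff

/-- A `Δ`-matroid on `[n]`: a nonempty family of subsets satisfying the symmetric exchange axiom.
The case `b = a` is allowed, and then `{a, b} = {a}`. -/
def IsDeltaMatroid {n : ℕ} (F : Set (Finset (Fin n))) : Prop :=
  F.Nonempty ∧ ∀ A ∈ F, ∀ B ∈ F, ∀ a ∈ A ∆ B, ∃ b ∈ A ∆ B, A ∆ {a, b} ∈ F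

/-- The indicator vector `e_S`. The map `S ↦ e_S` identifies the subsets of `[n]` with the
vertices `{0,1}^n` of the cube. -/
def indicatorVec {n : ℕ} (S : Finset (Fin n)) : Fin n → ℝ :=
  fun i => if i ∈ S then 1 else 0

/-- A `Δ`-matroid polytope: the convex hull of the indicator vectors of a `Δ`-matroid. -/
def IsDeltaMatroidPolytope {n : ℕ} (Q : Set (Fin n → ℝ)) : Prop :=
  ∃ F : Set (Finset (Fin n)), IsDeltaMatroid F ∧ Q = convexHull ℝ (indicatorVec '' F)

/-- The lifted polytope `P_p`, the convex hull of the points `(e_S, p(e_S))`. -/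
def liftedPolytope {n : ℕ} (p : Finset (Fin n) → ℝ) : Set ((Fin n → ℝ) × ℝ) :=
  convexHull ℝ (Set.range fun S : Finset (Fin n) => (indicatorVec S, p S))

/-- `G` is a lower face of `P`: it is the set of points of `P` that minimize a linear functional
whose last coordinate is positive. -/
def IsLowerFace {n : ℕ} (P G : Set ((Fin n → ℝ) × ℝ)) : Prop :=
  ∃ l : ((Fin n → ℝ) × ℝ) →ₗ[ℝ] ℝ, 0 < l (0, 1) ∧ G = {z ∈ P | ∀ w ∈ P, l z ≤ l w}

/-- The cells of the regular subdivision of the cube induced by `p`: the projections of the lower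
faces of the lifted polytope. -/
def inducedSubdivision {n : ℕ} (p : Finset (Fin n) → ℝ) : Set (Set (Fin n → ℝ)) :=
  {C | ∃ G, IsLowerFace (liftedPolytope p) G ∧ C = Prod.fst '' G}

/-- A real function on `{0,1}^n` is a valuated `Δ`-matroid if every cell of the subdivision it
induces is a `Δ`-matroid polytope. -/
def IsValuatedDeltaMatroid {n : ℕ} (p : Finset (Fin n) → ℝ) : Prop :=
  ∀ C ∈ inducedSubdivision p, IsDeltaMatroidPolytope C

/-- The `Δ`-Dressian on `[n]`. -/
def DeltaDressian (n : ℕ) : Set (Finset (Fin n) → ℝ) :=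
  {p | IsValuatedDeltaMatroid p}

/-- `A` contains a subset affinely equivalent to a `d`-dimensional ball. -/
def ContainsBall {V : Type*} [AddCommGroup V] [Module ℝ V] (A : Set V) (d : ℕ) : Prop :=
  ∃ f : EuclideanSpace ℝ (Fin d) →ᵃ[ℝ] V, Function.Injective f ∧
    f '' Metric.closedBall 0 1 ⊆ A

/-- `A` has dimension `d`: the number `d` is the largest one such that `A` contains a subset
affinely equivalent to a `d`-dimensional ball. -/
def HasDimension {V : Type*} [AddCommGroup V] [Module ℝ V] (A : Set V) (d : ℕ) : Prop :=
  IsGreatest {k : ℕ | ContainsBall A k} d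

/-!
A cell of the subdivision induced by `p` is the convex hull of the indicator vectors of the
minimizers of a tilt `S ↦ c(S) + p(S)`, and the vertices of the cube are in convex position. So `p`
lies in the `Δ`-Dressian if and only if the minimizers of every tilt of `p` form a `Δ`-matroid
(`mem_deltaDressian_iff`).

For the lower bound, every function that is positive on the even sets and zero on the odd ones
lies in the `Δ`-Dressian (`mem_deltaDressian_of_pos_even`): geometrically, the even vertices are cut
off from the demicube spanned by the odd ones. At least half of the vertices are even, also for
`n = 0`, and the values there vary freely.

For the upper bound, a cell with only two vertices joins sets that differ in at most two elements
(`hasShortEdges_of_mem_deltaDressian`), and this property passes to the faces of the cube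
(`HasShortEdges.face`). It fails for generic functions `q` on the vertices of the `4`-cube
(`dense_setOf_not_hasShortEdges`). Indeed, a generic `q` induces a triangulation, in which any two
vertices of a simplex span an edge. Write the centre of the cube as a convex combination of the
vertices of a simplex containing it, and fix a vertex `S` of positive weight. The weighted mean of
the Hamming distances from `S` is `2`, while `S` itself has distance `0`, so some vertex has
distance at least `3` from `S`. Hence restricting a ball in the `Δ`-Dressian to any of the `2 ^ m`
parallel `4`-faces of the `(4 + m)`-cube yields a set of dimension at most `15`, and the ball has
dimension at most `15 * 2 ^ m`.
-/

open scoped symmDiff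
open Filter Topology

/-! ### Cells and minimizers of tilts -/

/-- The sets `S` minimizing the tilt `S ↦ c(S) + p(S)` of `p` by the linear functional `c`. -/
def tiltMinimizers {n : ℕ} (p : Finset (Fin n) → ℝ) (c : Fin n → ℝ) : Set (Finset (Fin n)) :=
  {S | ∀ U, ∑ i ∈ S, c i + p S ≤ ∑ i ∈ U, c i + p U}

theorem tiltMinimizers_nonempty {n : ℕ} (p : Finset (Fin n) → ℝ) (c : Fin n → ℝ) :
    (tiltMinimizers p c).Nonempty :=
  Finite.exists_min fun S => ∑ i ∈ S, c i + p S

theorem setOf_minimizers_convexHull_range {ι E : Type*} [Finite ι] [AddCommGroup E] [Module ℝ E]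
    (g : ι → E) (l : E →ₗ[ℝ] ℝ) :
    {z ∈ convexHull ℝ (Set.range g) | ∀ w ∈ convexHull ℝ (Set.range g), l z ≤ l w} =
      convexHull ℝ (g '' {i | ∀ j, l (g i) ≤ l (g j)}) := by
  ext z
  constructor
  · rintro ⟨hz, hmin⟩
    obtain ⟨i₀⟩ : Nonempty ι := by
      by_contra h
      rw [not_nonempty_iff] at h
      simp [Set.range_eq_empty] at hz
    have : Nonempty ι := ⟨i₀⟩
    obtain ⟨i, hi⟩ := Finite.exists_min fun i => l (g i)
    -- A convex combination has value `l (g i)` only if no point of larger value takes part in it.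
    have hconv : Convex ℝ {x | l (g i) < l x ∨
        l x = l (g i) ∧ x ∈ convexHull ℝ (g '' {i | ∀ j, l (g i) ≤ l (g j)})} := by
      rw [convex_iff_forall_pos]
      rintro x hx y hy a b ha hb hab
      simp only [Set.mem_ofPred_eq, map_add, map_smul, smul_eq_mul] at hx hy ⊢
      have hsplit : l (g i) = a * l (g i) + b * l (g i) := by rw [← add_mul, hab, one_mul]
      rcases hx with hx | ⟨hx, hx'⟩
      · left
        have hy' : l (g i) ≤ l y := by rcases hy with hy | hy <;> [exact hy.le; exact hy.1.ge]
        have := mul_lt_mul_of_pos_left hx ha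
        have := mul_le_mul_of_nonneg_left hy' hb.le
        linarith
      · rcases hy with hy | ⟨hy, hy'⟩
        · left
          have := mul_lt_mul_of_pos_left hy hb
          rw [hx]
          linarith
        · right
          refine ⟨by rw [hx, hy]; linarith, ?_⟩
          exact convex_convexHull ℝ _ hx' hy' ha.le hb.le hab
    have hsub := convexHull_min (s := Set.range g) (by
      rintro _ ⟨j, rfl⟩
      rcases (hi j).lt_or_eq with h | h
      · exact Or.inl h
      · exact Or.inr ⟨h.symm, subset_convexHull ℝ _ ⟨j, fun k => h ▸ hi k, rfl⟩⟩) hconv hz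
    rcases hsub with h | h
    · exact absurd (hmin (g i) (subset_convexHull ℝ _ ⟨i, rfl⟩)) (not_le.2 h)
    · exact h.2
  · intro hz
    refine ⟨convexHull_mono (Set.image_subset_range _ _) hz, fun w hw => ?_⟩
    have hle : ∀ i, (∀ j, l (g i) ≤ l (g j)) → l (g i) ≤ l w := fun i hi =>
      convexHull_min (t := {x | l (g i) ≤ l x}) (by rintro _ ⟨j, rfl⟩; exact hi j)
        (convex_halfSpace_ge l.isLinear _) hw
    exact convexHull_min (t := {x | l x ≤ l w}) (by rintro _ ⟨i, hi, rfl⟩; exact hle i hi)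
      (convex_halfSpace_le l.isLinear _) hz

theorem sum_mul_indicatorVec {n : ℕ} (c : Fin n → ℝ) (S : Finset (Fin n)) :
    ∑ i, c i * indicatorVec S i = ∑ i ∈ S, c i := by
  simp [indicatorVec]

/-- The affine function `x ↦ ∑ i ∈ S, (1 - x i) + ∑ i ∉ S, x i` takes the value `#(S ∆ T)` at
`e_T`. -/
theorem sum_ite_indicatorVec {n : ℕ} (S T : Finset (Fin n)) :
    ∑ i, (if i ∈ S then 1 - indicatorVec T i else indicatorVec T i) = ((S ∆ T).card : ℝ) := by
  have : ((S ∆ T).card : ℝ) = ∑ i, if i ∈ S ∆ T then (1 : ℝ) else 0 := by simp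
  rw [this]
  refine Finset.sum_congr rfl fun i _ => ?_
  by_cases hS : i ∈ S <;> by_cases hT : i ∈ T <;> simp [indicatorVec, Finset.mem_symmDiff, hS, hT]

/-- The vertices of the cube are in convex position. -/
theorem indicatorVec_mem_convexHull_image {n : ℕ} {S : Finset (Fin n)}
    {F : Set (Finset (Fin n))} :
    indicatorVec S ∈ convexHull ℝ (indicatorVec '' F) ↔ S ∈ F := by
  refine ⟨fun h => ?_, fun h => subset_convexHull ℝ _ ⟨S, h, rfl⟩⟩
  by_contra hS
  have hconv : Convex ℝ {x : Fin n → ℝ | 1 ≤ ∑ i, if i ∈ S then 1 - x i else x i} := by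
    intro x hx y hy a b ha hb hab
    simp only [Set.mem_ofPred_eq] at hx hy ⊢
    have : ∑ i, (if i ∈ S then 1 - (a • x + b • y) i else (a • x + b • y) i) =
        a * (∑ i, if i ∈ S then 1 - x i else x i) + b * ∑ i, if i ∈ S then 1 - y i else y i := by
      rw [Finset.mul_sum, Finset.mul_sum, ← Finset.sum_add_distrib]
      refine Finset.sum_congr rfl fun i _ => ?_
      split_ifs
      · simp only [Pi.add_apply, Pi.smul_apply, smul_eq_mul]
        linear_combination -hab
      · simp
    rw [this]
    nlinarith
  have := convexHull_min (by
    rintro _ ⟨T, hT, rfl⟩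
    have hne : (S ∆ T).Nonempty := by
      rw [Finset.nonempty_iff_ne_empty]
      intro h0
      exact hS ((symmDiff_eq_bot.1 h0) ▸ hT)
    simp only [Set.mem_ofPred_eq, sum_ite_indicatorVec]
    exact_mod_cast hne.card_pos) hconv h
  simp only [Set.mem_ofPred_eq, sum_ite_indicatorVec] at this
  simp at this
  linarith

theorem fst_image_minimizers_liftedPolytope {n : ℕ} (p : Finset (Fin n) → ℝ)
    (l : ((Fin n → ℝ) × ℝ) →ₗ[ℝ] ℝ) :
    Prod.fst '' {z ∈ liftedPolytope p | ∀ w ∈ liftedPolytope p, l z ≤ l w} =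
      convexHull ℝ (indicatorVec '' {S | ∀ U, l (indicatorVec S, p S) ≤ l (indicatorVec U, p U)})
      := by
  rw [liftedPolytope, setOf_minimizers_convexHull_range]
  change (LinearMap.fst ℝ (Fin n → ℝ) ℝ) '' _ = _
  rw [LinearMap.image_convexHull, Set.image_image]
  rfl

/-- Cells of the induced subdivision correspond to families of minimizers of tilts of `p`. -/
theorem mem_deltaDressian_iff {n : ℕ} (p : Finset (Fin n) → ℝ) :
    p ∈ DeltaDressian n ↔ ∀ c, IsDeltaMatroid (tiltMinimizers p c) := by
  constructor
  · intro hp c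
    let l : ((Fin n → ℝ) × ℝ) →ₗ[ℝ] ℝ :=
      (∑ i, c i • LinearMap.proj i) ∘ₗ LinearMap.fst ℝ _ _ + LinearMap.snd ℝ _ _
    have hl : ∀ S, l (indicatorVec S, p S) = ∑ i ∈ S, c i + p S := fun S => by
      rw [← sum_mul_indicatorVec]; simp [l]
    obtain ⟨F, hF, hC⟩ := hp _ ⟨_, ⟨l, by simp [l], rfl⟩, rfl⟩
    rw [fst_image_minimizers_liftedPolytope] at hC
    have : tiltMinimizers p c = F := by
      ext S
      rw [← indicatorVec_mem_convexHull_image (F := F), ← hC, indicatorVec_mem_convexHull_image]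
      simp [hl, tiltMinimizers]
    exact this ▸ hF
  · rintro h C ⟨_, ⟨l, hl, rfl⟩, rfl⟩
    set t := l (0, 1)
    have key : ∀ S, l (indicatorVec S, p S) =
        t * (∑ i ∈ S, l (Pi.single i 1, 0) / t + p S) := fun S => by
      have hS : (indicatorVec S, p S) =
          (∑ i ∈ S, ((Pi.single i 1, 0) : (Fin n → ℝ) × ℝ)) + p S • (0, 1) := by
        ext i
        · simp [indicatorVec, Prod.fst_sum, Finset.sum_apply, Pi.single_apply]
        · simp [Prod.snd_sum]
      rw [hS, map_add, map_sum, map_smul, ← Finset.sum_div, mul_add, mul_div_cancel₀ _ hl.ne',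
        smul_eq_mul, mul_comm t (p S)]
    refine ⟨tiltMinimizers p fun i => l (Pi.single i 1, 0) / t, h _, ?_⟩
    rw [fst_image_minimizers_liftedPolytope]
    simp only [key, mul_le_mul_iff_right₀ hl]
    rfl

/-! ### A lower bound: heights vanishing on the odd sets -/

theorem sum_symmDiff_eq_add {n : ℕ} (c : Fin n → ℝ) (S D : Finset (Fin n)) :
    ∑ i ∈ S ∆ D, c i = ∑ i ∈ S, c i + ∑ i ∈ D, if i ∈ S then -c i else c i := by
  rw [← Finset.univ_inter (S ∆ D), ← Finset.univ_inter S, ← Finset.univ_inter D,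
    ← Finset.sum_ite_mem, ← Finset.sum_ite_mem, ← Finset.sum_ite_mem, ← Finset.sum_add_distrib]
  refine Finset.sum_congr rfl fun i _ => ?_
  by_cases hS : i ∈ S <;> by_cases hD : i ∈ D <;> simp [Finset.mem_symmDiff, hS, hD]

theorem even_card_symmDiff {α : Type*} [DecidableEq α] (S D : Finset α) :
    Even (S ∆ D).card ↔ (Even S.card ↔ Even D.card) := by
  have h : (S ∆ D).card = (S \ D).card + (D \ S).card :=
    Finset.card_union_of_disjoint disjoint_sdiff_sdiff
  have h1 := Finset.card_sdiff_add_card_inter S D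
  have h2 := Finset.card_sdiff_add_card_inter D S
  rw [Finset.inter_comm] at h2
  rw [h, ← h1, ← h2]
  simp only [Nat.even_add]
  tauto

/-- If `p` is positive on the even sets and zero on the odd ones, then the minimizers of a tilt
are either all odd, or they are an even set together with some of its neighbours in the cube. -/
theorem mem_deltaDressian_of_pos_even {n : ℕ} {p : Finset (Fin n) → ℝ}
    (hodd : ∀ S, ¬ Even S.card → p S = 0) (heven : ∀ S, Even S.card → 0 < p S) :
    p ∈ DeltaDressian n := by
  rw [mem_deltaDressian_iff]
  intro c
  refine ⟨tiltMinimizers_nonempty p c, ?_⟩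
  by_cases h : ∃ A ∈ tiltMinimizers p c, Even A.card
  · obtain ⟨C, hC, hCe⟩ := h
    have hnear : ∀ X, C ∆ X ∈ tiltMinimizers p c → X.card ≤ 1 := by
      intro X hX
      have hX := hX C
      rw [sum_symmDiff_eq_add] at hX
      have hw : ∀ i, p C ≤ if i ∈ C then -c i else c i := by
        intro i
        have hi := hC (C ∆ {i})
        rw [sum_symmDiff_eq_add, hodd (C ∆ {i}) (by simp [even_card_symmDiff, hCe]),
          Finset.sum_singleton] at hi
        linarith
      have hsum : X.card * p C ≤ ∑ i ∈ X, if i ∈ C then -c i else c i := by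
        rw [← nsmul_eq_mul]
        exact Finset.card_nsmul_le_sum X _ _ fun i _ => hw i
      have hp : 0 ≤ p (C ∆ X) := by
        by_cases hXe : Even (C ∆ X).card
        · exact (heven _ hXe).le
        · exact (hodd _ hXe).ge
      by_contra! h2
      have h2' : (2 : ℝ) ≤ X.card := by exact_mod_cast h2
      nlinarith [heven C hCe]
    have hsub : ∀ X : Finset (Fin n), X.card ≤ 1 → ∀ a ∈ X, X = {a} := fun X hX a ha =>
      Finset.eq_singleton_iff_unique_mem.2 ⟨ha, fun b hb => Finset.card_le_one.1 hX b hb a ha⟩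
    intro A hA B hB a ha
    obtain ⟨X, rfl⟩ : ∃ X, A = C ∆ X := ⟨C ∆ A, (symmDiff_symmDiff_cancel_left C A).symm⟩
    obtain ⟨Y, rfl⟩ : ∃ Y, B = C ∆ Y := ⟨C ∆ B, (symmDiff_symmDiff_cancel_left C B).symm⟩
    have hX1 := hsub X (hnear X hA)
    have hY1 := hsub Y (hnear Y hB)
    have hXY : (C ∆ X) ∆ (C ∆ Y) = X ∆ Y := by
      rw [symmDiff_symmDiff_symmDiff_comm]; simp
    rw [hXY] at ha ⊢
    by_cases haX : a ∈ X
    · refine ⟨a, ha, ?_⟩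
      rw [hX1 a haX]
      simpa using hC
    · have haY : a ∈ Y := by
        rw [Finset.mem_symmDiff] at ha
        tauto
      have hYa := hY1 a haY
      rcases X.eq_empty_or_nonempty with rfl | ⟨b, hb⟩
      · refine ⟨a, ha, ?_⟩
        rwa [Finset.pair_eq_singleton, ← hYa, ← Finset.bot_eq_empty, symmDiff_bot]
      · have hXb := hX1 b hb
        have hba : b ≠ a := fun h => haX (h ▸ hb)
        refine ⟨b, by simp [hXb, hYa, Finset.mem_symmDiff, hba], ?_⟩
        have : (C ∆ X) ∆ {a, b} = C ∆ Y := by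
          rw [symmDiff_assoc, hXb, hYa]
          congr 1
          ext x
          simp only [Finset.mem_symmDiff, Finset.mem_singleton, Finset.mem_insert]
          grind
        rwa [this]
  · push Not at h
    intro A hA B hB a ha
    set D := A ∆ B with hD
    have hB' : A ∆ D = B := symmDiff_symmDiff_cancel_left A B
    have hDe : Even D.card := by
      rw [hD, even_card_symmDiff]
      exact iff_of_false (h A hA) (h B hB)
    obtain ⟨b, hb, hba⟩ : ∃ b ∈ D, b ≠ a := by
      refine Finset.exists_mem_ne ?_ a
      have := Finset.card_pos.2 ⟨a, ha⟩
      obtain ⟨k, hk⟩ := hDe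
      lia
    refine ⟨b, hb, ?_⟩
    set E : Finset (Fin n) := {a, b} with hE
    have hEe : Even E.card := by rw [hE, Finset.card_pair hba.symm]; exact even_two
    have hED : E ⊆ D := by
      rw [hE, Finset.insert_subset_iff, Finset.singleton_subset_iff]
      exact ⟨ha, hb⟩
    have hDEe : Even (D \ E).card := by
      rw [Finset.card_sdiff_of_subset hED]
      exact hDe.tsub hEe
    have hoddA : ∀ Z : Finset (Fin n), Even Z.card → ¬ Even (A ∆ Z).card := fun Z hZ => by
      simp [even_card_symmDiff, hZ, h A hA]
    -- Moving along `D` does not change the value, and moving along `E` or `D \ E` does not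
    -- decrease it; hence moving along `E` does not change it either.
    have h1 := hA (A ∆ (D \ E))
    have h2 := hB A
    rw [← hB'] at h2
    rw [sum_symmDiff_eq_add, hodd _ (h A hA), hodd _ (hoddA _ hDEe)] at h1
    rw [sum_symmDiff_eq_add, hodd _ (h A hA), hodd _ (hoddA _ hDe)] at h2
    intro U
    have hU := hA U
    rw [hodd _ (h A hA)] at hU
    rw [sum_symmDiff_eq_add, hodd _ (hoddA _ hEe)]
    have := Finset.sum_sdiff hED (f := fun i => if i ∈ A then -c i else c i)
    linarith

theorem two_pow_le_two_mul_card_even (n : ℕ) :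
    2 ^ n ≤ 2 * Fintype.card {S : Finset (Fin n) // Even S.card} := by
  have hle : Fintype.card {S : Finset (Fin n) // ¬ Even S.card} ≤
      Fintype.card {S : Finset (Fin n) // Even S.card} := by
    cases n with
    | zero =>
      have : IsEmpty {S : Finset (Fin 0) // ¬ Even S.card} :=
        ⟨fun S => S.2 (by simp [Finset.eq_empty_of_isEmpty S.1])⟩
      rw [Fintype.card_eq_zero]
      exact Nat.zero_le _
    | succ n =>
      refine Fintype.card_le_of_injective
        (fun S => ⟨S.1 ∆ {0}, by simp [even_card_symmDiff, S.2]⟩) fun S T h => ?_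
      exact Subtype.ext (symmDiff_left_injective _ (Subtype.ext_iff.1 h))
  have := Fintype.card_subtype_compl fun S : Finset (Fin n) => Even S.card
  have hsub := Fintype.card_subtype_le fun S : Finset (Fin n) => Even S.card
  rw [Fintype.card_finset, Fintype.card_fin] at this hsub
  lia

theorem containsBall_card_even (n : ℕ) :
    ContainsBall (DeltaDressian n) (Fintype.card {S : Finset (Fin n) // Even S.card}) := by
  let e := Fintype.equivFin {S : Finset (Fin n) // Even S.card}
  let L : EuclideanSpace ℝ (Fin (Fintype.card {S : Finset (Fin n) // Even S.card})) →ₗ[ℝ]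
      (Finset (Fin n) → ℝ) :=
    { toFun := fun x S => if h : Even S.card then x (e ⟨S, h⟩) else 0
      map_add' := fun x y => by ext S; by_cases h : Even S.card <;> simp [h]
      map_smul' := fun r x => by ext S; by_cases h : Even S.card <;> simp [h] }
  let v : Finset (Fin n) → ℝ := fun S => if Even S.card then 2 else 0
  refine ⟨L.toAffineMap + AffineMap.const ℝ _ v, fun x y hxy => ?_, ?_⟩
  · ext i
    have := congrFun hxy (e.symm i).1
    simpa [L, v, (e.symm i).2] using this
  · rintro _ ⟨x, hx, rfl⟩
    refine mem_deltaDressian_of_pos_even (fun S hS => by simp [L, v, hS]) fun S hS => ?_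
    have hxi : |x (e ⟨S, hS⟩)| ≤ 1 := by
      rw [mem_closedBall_zero_iff] at hx
      exact (PiLp.norm_apply_le x _).trans hx
    have : (L x + v) S = x (e ⟨S, hS⟩) + 2 := by
      simp [L, v, hS]
    change 0 < (L x + v) S
    rw [this]
    linarith [(abs_le.1 hxi).1]

/-! ### Edges of cells and faces of the cube -/

/-- All edges occurring among the cells of the subdivision induced by `p` are short: if the
minimizers of a tilt of `p` are exactly `S` and `S'`, then `S` and `S'` differ in at most two
elements. -/
def HasShortEdges {n : ℕ} (p : Finset (Fin n) → ℝ) : Prop :=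
  ∀ (c : Fin n → ℝ) (S S' : Finset (Fin n)), ∑ i ∈ S, c i + p S = ∑ i ∈ S', c i + p S' →
    (∀ U, U ≠ S → U ≠ S' → ∑ i ∈ S, c i + p S < ∑ i ∈ U, c i + p U) → (S ∆ S').card ≤ 2

theorem hasShortEdges_of_mem_deltaDressian {n : ℕ} {p : Finset (Fin n) → ℝ}
    (hp : p ∈ DeltaDressian n) : HasShortEdges p := by
  intro c S S' heq hlt
  have hmem : ∀ U, U ∈ tiltMinimizers p c ↔ U = S ∨ U = S' := by
    intro U
    constructor
    · intro hU
      by_contra! hne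
      exact (hlt U hne.1 hne.2).not_ge (hU S)
    · have hS : S ∈ tiltMinimizers p c := fun V => by
        by_cases h1 : V = S
        · rw [h1]
        by_cases h2 : V = S'
        · rw [h2, heq]
        exact (hlt V h1 h2).le
      rintro (rfl | rfl)
      · exact hS
      · exact fun V => heq ▸ hS V
  rcases (S ∆ S').eq_empty_or_nonempty with h | ⟨a, ha⟩
  · simp [h]
  obtain ⟨b, -, hb⟩ := ((mem_deltaDressian_iff p).1 hp c).2 S ((hmem S).2 (Or.inl rfl)) S'
    ((hmem S').2 (Or.inr rfl)) a ha
  rcases (hmem _).1 hb with h | h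
  · rw [symmDiff_eq_left] at h
    exact absurd h (Finset.insert_ne_empty _ _)
  · rw [← h, symmDiff_symmDiff_cancel_left]
    exact Finset.card_le_two

/-- The vertices of the `(k + m)`-cube, split into the parallel copies of the `k`-cube indexed by
the vertices of the `m`-cube. -/
def cubeVertexEquiv (k m : ℕ) : Finset (Fin k) × Finset (Fin m) ≃ Finset (Fin (k + m)) :=
  Finset.sumEquiv.symm.toEquiv.trans (Equiv.finsetCongr finSumFinEquiv)

theorem sum_cubeVertexEquiv {k m : ℕ} (c : Fin (k + m) → ℝ) (R : Finset (Fin k))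
    (T : Finset (Fin m)) :
    ∑ i ∈ cubeVertexEquiv k m (R, T), c i =
      ∑ i ∈ R, c (Fin.castAdd m i) + ∑ j ∈ T, c (Fin.natAdd k j) := by
  simp [cubeVertexEquiv, Finset.sumEquiv]

theorem castAdd_mem_cubeVertexEquiv {k m : ℕ} (i : Fin k) (R : Finset (Fin k))
    (T : Finset (Fin m)) : Fin.castAdd m i ∈ cubeVertexEquiv k m (R, T) ↔ i ∈ R := by
  simp [cubeVertexEquiv, Finset.sumEquiv, ← finSumFinEquiv_apply_left]

/-- Short edges are inherited by the faces of the cube: a large weight on the remaining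
coordinates turns the cells of the restriction to the face into cells of `p`. -/
theorem HasShortEdges.face {k m : ℕ} {p : Finset (Fin (k + m)) → ℝ} (hp : HasShortEdges p)
    (T : Finset (Fin m)) : HasShortEdges fun R => p (cubeVertexEquiv k m (R, T)) := by
  intro c R R' heq hlt
  obtain ⟨M, hM⟩ := Finite.bddAbove_range fun V : Finset (Fin k) × Finset (Fin m) =>
    ∑ i ∈ R, c i + p (cubeVertexEquiv k m (R, T)) -
      (∑ i ∈ V.1, c i + p (cubeVertexEquiv k m V))
  have hM : ∀ V W, ∑ i ∈ R, c i + p (cubeVertexEquiv k m (R, T)) -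
      (∑ i ∈ V, c i + p (cubeVertexEquiv k m (V, W))) ≤ M := fun V W => hM ⟨(V, W), rfl⟩
  have hM0 : 0 ≤ M := by simpa using hM R T
  let c' : Fin (k + m) → ℝ := Fin.addCases c fun j => if j ∈ T then -(M + 1) else M + 1
  have hc' : ∀ V W, ∑ i ∈ cubeVertexEquiv k m (V, W), c' i = ∑ i ∈ V, c i +
      (∑ j ∈ T, -(M + 1) + (W ∆ T).card * (M + 1)) := by
    intro V W
    rw [sum_cubeVertexEquiv]
    simp only [c', Fin.addCases_left, Fin.addCases_right]
    congr 1
    obtain ⟨D, rfl⟩ : ∃ D, W = T ∆ D := ⟨T ∆ W, (symmDiff_symmDiff_cancel_left T W).symm⟩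
    rw [sum_symmDiff_eq_add, symmDiff_comm T D, symmDiff_symmDiff_cancel_right]
    congr 1
    · exact Finset.sum_congr rfl fun j hj => by simp [hj]
    · rw [← nsmul_eq_mul]
      exact Finset.sum_eq_card_nsmul fun j _ => by split_ifs <;> simp
  have := hp c' (cubeVertexEquiv k m (R, T)) (cubeVertexEquiv k m (R', T)) (by
    rw [hc', hc']; linarith) (by
    intro U hU hU'
    obtain ⟨⟨V, W⟩, rfl⟩ := (cubeVertexEquiv k m).surjective U
    rw [hc', hc']
    by_cases hW : W = T
    · subst hW
      have := hlt V (fun h => hU (by rw [h])) (fun h => hU' (by rw [h]))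
      linarith
    · have hpos : (1 : ℝ) ≤ (W ∆ T).card := by
        have : (W ∆ T).Nonempty := by
          rw [Finset.nonempty_iff_ne_empty]
          exact fun h => hW (symmDiff_eq_bot.1 h)
        exact_mod_cast this.card_pos
      have := hM V W
      simp only [symmDiff_self, Finset.bot_eq_empty, Finset.card_empty, Nat.cast_zero]
      nlinarith)
  refine le_trans ?_ this
  refine Finset.card_le_card_of_injOn (Fin.castAdd m) (fun i hi => ?_)
    (Fin.castAdd_injective k m).injOn
  rw [Finset.mem_coe, Finset.mem_symmDiff] at hi ⊢
  simpa only [castAdd_mem_cubeVertexEquiv] using hi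

/-! ### Generic heights on the four-dimensional cube -/

/-- Some cell of the induced subdivision contains the centre of the cube. The tilt is found by
maximizing the value at the centre of an affine function lying below `q`. -/
theorem exists_center_mem_convexHull_tiltMinimizers {n : ℕ} (q : Finset (Fin n) → ℝ) :
    ∃ c, (fun _ => 1 / 2 : Fin n → ℝ) ∈ convexHull ℝ (indicatorVec '' tiltMinimizers q c) := by
  let φ : (Fin n → ℝ) → Finset (Fin n) → ℝ := fun c S =>
    ∑ i, c i * (indicatorVec S i - 1 / 2) + q S
  let μ : (Fin n → ℝ) → ℝ := fun c => Finset.univ.inf' Finset.univ_nonempty (φ c)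
  have hφ : ∀ c S, φ c S = ∑ i ∈ S, c i + q S - ∑ i, c i * (1 / 2) := by
    intro c S
    simp only [φ, mul_sub, Finset.sum_sub_distrib, sum_mul_indicatorVec]
    ring
  have hcont : Continuous μ :=
    Continuous.finset_inf'_apply Finset.univ_nonempty fun S _ => by
      fun_prop
  obtain ⟨Q, hQ⟩ := Finite.bddAbove_range q
  have hQ : ∀ S, q S ≤ Q := fun S => hQ ⟨S, rfl⟩
  have hcoer : Tendsto μ (cocompact _) atBot := by
    have hle : ∀ c, μ c ≤ Q + -(‖c‖ * (1 / 2)) := by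
      intro c
      let S : Finset (Fin n) := Finset.univ.filter fun i => c i ≤ 0
      have hS : ∀ i, c i * (indicatorVec S i - 1 / 2) = -(|c i| * (1 / 2)) := by
        intro i
        by_cases h : c i ≤ 0
        · rw [abs_of_nonpos h, indicatorVec, if_pos (by simpa [S] using h)]
          ring
        · rw [abs_of_pos (not_le.1 h), indicatorVec, if_neg (by simpa [S] using h)]
          ring
      have hnorm : ‖c‖ ≤ ∑ i, |c i| := by
        refine (pi_norm_le_iff_of_nonneg (Finset.sum_nonneg fun i _ => abs_nonneg _)).2 fun i => ?_
        exact Finset.single_le_sum (f := fun i => |c i|) (fun i _ => abs_nonneg _)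
          (Finset.mem_univ i)
      have h1 : μ c ≤ φ c S := Finset.inf'_le _ (Finset.mem_univ S)
      have h2 : φ c S = -((∑ i, |c i|) * (1 / 2)) + q S := by
        simp only [φ, hS, Finset.sum_neg_distrib, Finset.sum_mul]
      linarith [hQ S]
    refine tendsto_atBot_mono hle (tendsto_atBot_add_const_left _ _ ?_)
    exact tendsto_neg_atTop_atBot.comp
      ((tendsto_norm_cocompact_atTop (E := Fin n → ℝ)).atTop_mul_const (by norm_num))
  obtain ⟨c, hc⟩ := hcont.exists_forall_ge hcoer
  refine ⟨c, ?_⟩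
  by_contra hnot
  -- A separating functional gives a direction in which all minimal values increase.
  obtain ⟨f, u, hfu, hu⟩ := geometric_hahn_banach_point_closed (convex_convexHull ℝ _)
    (((Set.toFinite _).image indicatorVec).isClosed_convexHull ℝ) hnot
  let d : Fin n → ℝ := fun i => f (Pi.single i 1)
  have hd : ∀ x, f x = ∑ i, d i * x i := fun x => by
    conv_lhs => rw [← Finset.univ_sum_single x]
    rw [map_sum]
    refine Finset.sum_congr rfl fun i _ => ?_
    have : (Pi.single i (x i) : Fin n → ℝ) = x i • Pi.single i 1 := by
      rw [← Pi.single_smul, smul_eq_mul, mul_one]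
    rw [this, map_smul, smul_eq_mul, mul_comm]
  have hstep : ∀ (ε : ℝ) S, φ (c + ε • d) S =
      φ c S + ε * (f (indicatorVec S) - f fun _ => 1 / 2) := by
    intro ε S
    simp only [φ, hd, ← Finset.sum_sub_distrib, Finset.mul_sum, Pi.add_apply, Pi.smul_apply,
      smul_eq_mul]
    rw [add_right_comm, ← Finset.sum_add_distrib]
    congr 1
    exact Finset.sum_congr rfl fun i _ => by ring
  have hev : ∀ S, ∀ᶠ ε : ℝ in 𝓝[>] 0, μ c < φ (c + ε • d) S := by
    intro S
    have hle : μ c ≤ φ c S := Finset.inf'_le _ (Finset.mem_univ S)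
    by_cases hS : S ∈ tiltMinimizers q c
    · filter_upwards [self_mem_nhdsWithin] with ε hε
      have hpos := mul_pos (Set.mem_Ioi.1 hε) (sub_pos.2
        (hfu.trans (hu _ (subset_convexHull ℝ _ ⟨S, hS, rfl⟩))))
      rw [hstep]
      linarith
    · have hlt : μ c < φ c S := by
        simp only [tiltMinimizers, Set.mem_ofPred_eq, not_forall, not_le] at hS
        obtain ⟨U, hU⟩ := hS
        have : μ c ≤ φ c U := Finset.inf'_le _ (Finset.mem_univ U)
        rw [hφ] at this ⊢
        linarith
      have hlim : Tendsto (fun ε : ℝ => φ (c + ε • d) S) (𝓝 0) (𝓝 (φ c S)) := by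
        simp only [hstep]
        exact Continuous.tendsto' (by fun_prop) _ _ (by simp)
      exact (hlim.eventually_const_lt hlt).filter_mono nhdsWithin_le_nhds
  obtain ⟨ε, hε⟩ := (eventually_all.2 hev).exists
  exact (hc (c + ε • d)).not_gt ((Finset.lt_inf'_iff _).2 fun S _ => hε S)

/-- The functions on the vertices of the cube that agree on `F` with an affine function. -/
def affineOn {n : ℕ} (F : Set (Finset (Fin n))) : Submodule ℝ (Finset (Fin n) → ℝ) where
  carrier := {q | ∃ (c : Fin n → ℝ) (t : ℝ), ∀ S ∈ F, q S = ∑ i ∈ S, c i + t}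
  zero_mem' := ⟨0, 0, fun S _ => by simp⟩
  add_mem' := by
    rintro q q' ⟨c, t, h⟩ ⟨c', t', h'⟩
    refine ⟨c + c', t + t', fun S hS => ?_⟩
    simp only [Pi.add_apply, h S hS, h' S hS, Finset.sum_add_distrib]
    ring
  smul_mem' := by
    rintro r q ⟨c, t, h⟩
    refine ⟨r • c, r * t, fun S hS => ?_⟩
    simp only [Pi.smul_apply, smul_eq_mul, h S hS, mul_add, Finset.mul_sum]

theorem mem_affineOn_tiltMinimizers {n : ℕ} (q : Finset (Fin n) → ℝ) (c : Fin n → ℝ) :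
    q ∈ affineOn (tiltMinimizers q c) := by
  obtain ⟨S₀, hS₀⟩ := tiltMinimizers_nonempty q c
  refine ⟨-c, ∑ i ∈ S₀, c i + q S₀, fun S hS => ?_⟩
  have h1 := hS S₀
  have h2 := hS₀ S
  simp only [Pi.neg_apply, Finset.sum_neg_distrib]
  linarith

/-- If every function agrees on the family of minimizers with an affine one, that is, if the cell
is a simplex, then any two of its vertices span an edge. -/
theorem HasShortEdges.card_symmDiff_le {n : ℕ} {q : Finset (Fin n) → ℝ} (hq : HasShortEdges q)
    {c : Fin n → ℝ} (htop : affineOn (tiltMinimizers q c) = ⊤) {S S' : Finset (Fin n)}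
    (hS : S ∈ tiltMinimizers q c) (hS' : S' ∈ tiltMinimizers q c) : (S ∆ S').card ≤ 2 := by
  classical
  obtain ⟨d, t, hd⟩ : (fun U => if U = S ∨ U = S' then 0 else 1) ∈
    affineOn (tiltMinimizers q c) := htop ▸ Submodule.mem_top
  have hdS : ∑ i ∈ S, d i + t = 0 := by simpa using (hd S hS).symm
  have hdS' : ∑ i ∈ S', d i + t = 0 := by simpa using (hd S' hS').symm
  have hstep : ∀ (ε : ℝ) (U : Finset (Fin n)),
      ∑ i ∈ U, (c + ε • d) i = ∑ i ∈ U, c i + ε * ∑ i ∈ U, d i := fun ε U => by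
    simp [Finset.sum_add_distrib, Finset.mul_sum]
  have hev : ∀ U, ∀ᶠ ε : ℝ in 𝓝[>] 0, U ≠ S → U ≠ S' →
      ∑ i ∈ S, (c + ε • d) i + q S < ∑ i ∈ U, (c + ε • d) i + q U := by
    intro U
    simp only [hstep]
    have hle := hS U
    by_cases hU : U ∈ tiltMinimizers q c
    · filter_upwards [self_mem_nhdsWithin] with ε hε h1 h2
      have hdU := hd U hU
      simp only [h1, h2, or_self, if_false] at hdU
      have : ε * ∑ i ∈ U, d i = ε * ∑ i ∈ S, d i + ε := by
        linear_combination -ε * hdS - ε * hdU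
      linarith [Set.mem_Ioi.1 hε]
    · have hlt : ∑ i ∈ S, c i + q S < ∑ i ∈ U, c i + q U := by
        simp only [tiltMinimizers, Set.mem_ofPred_eq, not_forall, not_le] at hU
        obtain ⟨V, hV⟩ := hU
        exact (hS V).trans_lt hV
      have h1 : Tendsto (fun ε : ℝ => ∑ i ∈ S, c i + ε * ∑ i ∈ S, d i + q S) (𝓝 0)
          (𝓝 (∑ i ∈ S, c i + q S)) := Continuous.tendsto' (by fun_prop) _ _ (by simp)
      have h2 : Tendsto (fun ε : ℝ => ∑ i ∈ U, c i + ε * ∑ i ∈ U, d i + q U) (𝓝 0)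
          (𝓝 (∑ i ∈ U, c i + q U)) := Continuous.tendsto' (by fun_prop) _ _ (by simp)
      filter_upwards [(h1.eventually_lt h2 hlt).filter_mono nhdsWithin_le_nhds] with ε hε _ _
      exact hε
  obtain ⟨ε, hε⟩ := (eventually_all.2 hev).exists
  refine hq (c + ε • d) S S' ?_ hε
  rw [hstep, hstep]
  have h1 := hS S'
  have h2 := hS' S
  have : ε * ∑ i ∈ S, d i = ε * ∑ i ∈ S', d i := by linear_combination ε * (hdS - hdS')
  linarith

/-- A family of vertices of the `n`-cube, `n ≥ 4`, whose convex hull contains the centre has two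
members at distance greater than two: in a convex combination equal to the centre, the mean
distance from a fixed member `S` is `n / 2`, and `S` itself, at distance zero, has positive
weight. -/
theorem exists_two_lt_card_symmDiff {n : ℕ} (hn : 4 ≤ n) {F : Set (Finset (Fin n))}
    (hF : (fun _ => 1 / 2 : Fin n → ℝ) ∈ convexHull ℝ (indicatorVec '' F)) :
    ∃ S ∈ F, ∃ T ∈ F, 2 < (S ∆ T).card := by
  by_contra! hle
  rw [convexHull_eq] at hF
  obtain ⟨ι, s, w, z, hw, hw1, hz, hcenter⟩ := hF
  rw [Finset.centerMass_eq_of_sum_1 _ _ hw1] at hcenter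
  choose! A hA hAz using hz
  obtain ⟨j, hj, hjpos⟩ : ∃ j ∈ s, 0 < w j := by
    by_contra! h
    have := Finset.sum_nonpos h
    linarith
  have hmean : ∑ a ∈ s, w a * ((A j ∆ A a).card : ℝ) = n * (1 / 2) := by
    have hcoord : ∀ i, ∑ a ∈ s, w a * indicatorVec (A a) i = 1 / 2 := fun i => by
      have := congrFun hcenter i
      rw [Finset.sum_apply] at this
      rw [← this]
      exact Finset.sum_congr rfl fun a ha => by simp [hAz a ha]
    simp only [← sum_ite_indicatorVec, Finset.mul_sum]
    rw [Finset.sum_comm]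
    have : ∀ i ∈ (Finset.univ : Finset (Fin n)), (∑ a ∈ s, w a *
        if i ∈ A j then 1 - indicatorVec (A a) i else indicatorVec (A a) i) = 1 / 2 := by
      intro i _
      split_ifs
      · simp only [mul_sub, mul_one, Finset.sum_sub_distrib, hw1, hcoord]
        norm_num
      · exact hcoord i
    rw [Finset.sum_congr rfl this]
    simp
  have hlt : ∑ a ∈ s, w a * ((A j ∆ A a).card : ℝ) < ∑ a ∈ s, w a * 2 := by
    refine Finset.sum_lt_sum (fun a ha => ?_) ⟨j, hj, by simpa using hjpos⟩
    exact mul_le_mul_of_nonneg_left (by exact_mod_cast hle _ (hA j hj) _ (hA a ha)) (hw a ha)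
  rw [hmean, ← Finset.sum_mul, hw1] at hlt
  have : (4 : ℝ) ≤ n := by exact_mod_cast hn
  linarith

theorem Submodule.dense_compl_of_ne_top {V : Type*} [NormedAddCommGroup V] [NormedSpace ℝ V]
    {N : Submodule ℝ V} (hN : N ≠ ⊤) : Dense ((N : Set V)ᶜ) := by
  rw [← interior_eq_empty_iff_dense_compl]
  by_contra h
  exact hN (N.eq_top_of_nonempty_interior' (Set.nonempty_iff_ne_empty.2 h))

/-- A generic function on the vertices of the cube induces a triangulation, and the simplex that
contains the centre has a long edge. -/
theorem dense_setOf_not_hasShortEdges {n : ℕ} (hn : 4 ≤ n) :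
    Dense {q : Finset (Fin n) → ℝ | ¬ HasShortEdges q} := by
  have hgen : Dense (⋂ F : {F : Set (Finset (Fin n)) // affineOn F ≠ ⊤},
      ((affineOn F.1 : Set (Finset (Fin n) → ℝ))ᶜ)) :=
    dense_iInter_of_isOpen (fun F => (affineOn F.1).closed_of_finiteDimensional.isOpen_compl)
      fun F => Submodule.dense_compl_of_ne_top F.2
  refine hgen.mono fun q hq hshort => ?_
  obtain ⟨c, hc⟩ := exists_center_mem_convexHull_tiltMinimizers q
  have htop : affineOn (tiltMinimizers q c) = ⊤ := by
    by_contra h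
    exact Set.mem_iInter.1 hq ⟨_, h⟩ (mem_affineOn_tiltMinimizers q c)
  obtain ⟨S, hS, T, hT, hlt⟩ := exists_two_lt_card_symmDiff hn hc
  exact hlt.not_ge (hshort.card_symmDiff_le htop hS hT)

/-! ### Counting dimensions -/

/-- The restriction of the direction space of a ball in the `Δ`-Dressian to a face of dimension at
least four is a proper subspace, as otherwise the restrictions of the points of the ball would
contain an open set. -/
theorem not_surjective_face {k m d : ℕ} (hk : 4 ≤ k)
    {f : EuclideanSpace ℝ (Fin d) →ᵃ[ℝ] (Finset (Fin (k + m)) → ℝ)}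
    (hf : f '' Metric.closedBall 0 1 ⊆ DeltaDressian (k + m)) (T : Finset (Fin m)) :
    ¬ Function.Surjective
      (LinearMap.funLeft ℝ ℝ (fun R => cubeVertexEquiv k m (R, T)) ∘ₗ f.linear) := by
  intro hsurj
  set g := LinearMap.funLeft ℝ ℝ (fun R => cubeVertexEquiv k m (R, T))
  have hopen : IsOpenMap fun x => g (f x) := by
    have : (fun x => g (f x)) = (fun y => y + g (f 0)) ∘ (g ∘ₗ f.linear) := by
      ext1 x
      rw [congrFun f.decomp x]
      simp
    rw [this]
    exact (isOpenMap_add_right _).comp (LinearMap.isOpenMap_of_finiteDimensional _ hsurj)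
  obtain ⟨x, hx, hxball⟩ := ((dense_setOf_not_hasShortEdges hk).preimage hopen).exists_mem_open
    Metric.isOpen_ball ⟨0, Metric.mem_ball_self (zero_lt_one (α := ℝ))⟩
  exact hx ((hasShortEdges_of_mem_deltaDressian
    (hf ⟨x, Metric.ball_subset_closedBall hxball, rfl⟩)).face T)

theorem ContainsBall.le_two_pow {n d : ℕ} {A : Set (Finset (Fin n) → ℝ)}
    (h : ContainsBall A d) : d ≤ 2 ^ n := by
  obtain ⟨f, hf, -⟩ := h
  simpa using LinearMap.finrank_le_finrank_of_injective (f.linear_injective_iff.2 hf)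

theorem ContainsBall.le_fifteen_mul {m d : ℕ} (h : ContainsBall (DeltaDressian (4 + m)) d) :
    d ≤ 15 * 2 ^ m := by
  obtain ⟨f, hf, hball⟩ := h
  let g (T : Finset (Fin m)) :=
    LinearMap.funLeft ℝ ℝ (fun R => cubeVertexEquiv 4 m (R, T)) ∘ₗ f.linear
  have hinj : Function.Injective (LinearMap.pi fun T => (g T).rangeRestrict) := by
    rw [injective_iff_map_eq_zero]
    intro x hx
    refine (injective_iff_map_eq_zero f.linear).1 (f.linear_injective_iff.2 hf) x ?_
    ext U
    obtain ⟨⟨R, T⟩, rfl⟩ := (cubeVertexEquiv 4 m).surjective U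
    exact congrFun (Subtype.ext_iff.1 (congrFun hx T)) R
  have hrank : ∀ T, Module.finrank ℝ (LinearMap.range (g T)) ≤ 15 := by
    intro T
    have hlt := Submodule.finrank_lt (mt LinearMap.range_eq_top.1
      (not_surjective_face le_rfl hball T))
    have : Module.finrank ℝ (Finset (Fin 4) → ℝ) = 16 := by simp
    rw [this] at hlt
    exact Nat.lt_succ_iff.1 hlt
  have hle := LinearMap.finrank_le_finrank_of_injective hinj
  rw [finrank_euclideanSpace_fin, Module.finrank_pi_fintype] at hle
  calc d ≤ _ := hle
    _ ≤ ∑ _ : Finset (Fin m), 15 := Finset.sum_le_sum fun T _ => hrank T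
    _ = 15 * 2 ^ m := by simp [mul_comm]

theorem mainTheorem6 (n : ℕ) :
    ∃ d : ℕ, HasDimension (DeltaDressian n) d ∧
      (1 / 2 : ℝ) * 2 ^ n ≤ (d : ℝ) ∧
      (4 ≤ n → (d : ℝ) ≤ (15 / 16 : ℝ) * 2 ^ n) := by
  have hbdd : BddAbove {k : ℕ | ContainsBall (DeltaDressian n) k} :=
    ⟨2 ^ n, fun k hk => hk.le_two_pow⟩
  have hmem := Nat.sSup_mem ⟨_, containsBall_card_even n⟩ hbdd
  refine ⟨sSup {k : ℕ | ContainsBall (DeltaDressian n) k},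
    ⟨hmem, fun k hk => le_csSup hbdd hk⟩, ?_, fun hn => ?_⟩
  · have h1 : (2 : ℝ) ^ n ≤ 2 * Fintype.card {S : Finset (Fin n) // Even S.card} := by
      exact_mod_cast two_pow_le_two_mul_card_even n
    have h2 : (Fintype.card {S : Finset (Fin n) // Even S.card} : ℝ) ≤
        (sSup {k : ℕ | ContainsBall (DeltaDressian n) k} : ℕ) := by
      exact_mod_cast le_csSup hbdd (containsBall_card_even n)
    linarith
  · obtain ⟨m, rfl⟩ := Nat.exists_eq_add_of_le hn
    have h : ((sSup {k : ℕ | ContainsBall (DeltaDressian (4 + m)) k} : ℕ) : ℝ) ≤ 15 * 2 ^ m := by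
      exact_mod_cast ContainsBall.le_fifteen_mul hmem
    rw [pow_add]
    linarith
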